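/- Let $T,\alpha,\beta>0$. Let $M(0,T)$ be the space of finite signed Radon measures on $(0,T)$ with the total variation norm $\|\cdot\|_M$, and let $\mathrm{BV}(0,T)$ be the space of all $u\in L^1(0,T)$ whose distributional derivative $Du$ belongs to $M(0,T)$; recall $\mathrm{BV}(0,T)\subset L^2(0,T)$. For $u\in\mathrm{BV}(0,T)$ set $$\operatorname{TGV}(u)=\inf_{w\in \mathrm{BV}(0,T)}\ \alpha\|Du-w\|_M+\beta\|Dw\|_M ,$$ where $w$ is identified with the measure of density $w$. Let $f\colon L^2(0,T)\to\mathbb R$ be Fréchet differentiable (not necessarily convex), with $\nabla f(u)\in L^2(0,T)$ the Riesz representative of its derivative at $u$. For $\bar u\in \mathrm{BV}(0,T)$ put $$\bar p(x)=\int_0^x\nabla f(\bar u)(t)\,dt,\qquad \bar P(x)=-\int_0^x\bar p(t)\,dt .$$ Consider the conditions (i) $\bar p\in H^1_0(0,T)$, $\bar P\in H^2(0,T)\cap H^1_0(0,T)$, $|\bar p|\le\alpha$ and $|\bar P|\le\beta$ on $(0,T)$; (ii) for a given $\bar w\in\mathrm{BV}(0,T)$ with $\operatorname{TGV}(\bar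 u)=\alpha\|D\bar u-\bar w\|_M+\beta\|D\bar w\|_M$, $$\operatorname{supp}(D\bar u-\bar w)_\pm\subset\{x\in(0,T): \bar p(x)=\pm\alpha\},\qquad \operatorname{supp}(D\bar w)_\pm\subset\{x\in(0,T): \bar P(x)=\pm\beta\},$$ where $\mu=\mu_+-\mu_-$ is the Jordan decomposition of $\mu\in M(0,T)$ and supports are taken in $(0,T)$. If $\bar u$ minimizes $f+\operatorname{TGV}$ over $\mathrm{BV}(0,T)$, then (i) holds, and (ii) holds for every such $\bar w$. Conversely, if $f$ is convex and $\bar u\in\mathrm{BV}(0,T)$ satisfies (i), and (ii) for some such $\bar w$, then $\bar u$ minimizes $f+\operatorname{TGV}$ over $\mathrm{BV}(0,T)$. -/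

import Mathlib

open MeasureTheory Set Filter Topology
open scoped ContDiff ENNReal Gradient

noncomputable section

/-- Lebesgue measure on the interval `(0, T)`. -/
abbrev lebI (T : ℝ) : Measure ℝ := volume.restrict (Ioo 0 T)

/-- The Hilbert space `L²(0, T)`. -/
abbrev L2I (T : ℝ) : Type := Lp ℝ 2 (lebI T)

/-- `φ ∈ C_c^∞(0, T)`. -/
structure IsTestFun (T : ℝ) (φ : ℝ → ℝ) : Prop where
  smooth : ContDiff ℝ ∞ φ
  compact : HasCompactSupport φ
  supp : tsupport φ ⊆ Ioo 0 T

/-- `∫ φ dμ` for a finite signed measure `μ`, by the Jordan decomposition `μ = μ₊ - μ₋`. -/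
def sIntegral (μ : SignedMeasure ℝ) (φ : ℝ → ℝ) : ℝ :=
  ∫ x, φ x ∂μ.toJordanDecomposition.posPart - ∫ x, φ x ∂μ.toJordanDecomposition.negPart

/-- The norm `‖μ‖_M = |μ|(ℝ)`. -/
def mNorm (μ : SignedMeasure ℝ) : ℝ := (μ.totalVariation univ).toReal

/-- `HasBVDeriv T u μ`: the function `u` is in `BV(0, T)` with distributional derivative `Du = μ`.
Elements of `M(0, T)` are the finite signed measures on `ℝ` that live on `(0, T)`. -/
structure HasBVDeriv (T : ℝ) (u : ℝ → ℝ) (μ : SignedMeasure ℝ) : Prop where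
  integrable : Integrable u (lebI T)
  concentrated : μ.totalVariation (Ioo 0 T)ᶜ = 0
  byParts : ∀ φ, IsTestFun T φ → ∫ x, u x * deriv φ x ∂(lebI T) = -sIntegral μ φ

/-- `u ∈ BV(0, T)`. -/
def MemBV (T : ℝ) (u : ℝ → ℝ) : Prop := ∃ μ, HasBVDeriv T u μ

/-- For `w ∈ L¹(0, T)`, the measure on `(0, T)` with density `w`. -/
def densityI (T : ℝ) (w : ℝ → ℝ) : SignedMeasure ℝ := (lebI T).withDensityᵥ w

/-- The total generalized variation of order two of `u ∈ BV(0, T)`: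
`inf_{w ∈ BV(0, T)} α ‖Du - w‖_M + β ‖Dw‖_M`. -/
def TGV (T α β : ℝ) (u : ℝ → ℝ) : ℝ :=
  sInf {r : ℝ | ∃ (w : ℝ → ℝ) (μ ν : SignedMeasure ℝ), HasBVDeriv T u μ ∧ HasBVDeriv T w ν ∧
    r = α * mNorm (μ - densityI T w) + β * mNorm ν}

/-- `u` minimizes `f + TGV` over `BV(0, T)`, a subset of `L²(0, T)`. -/
def IsTGVMinimizer (T α β : ℝ) (f : L2I T → ℝ) (u : L2I T) : Prop :=
  MemBV T u ∧ ∀ v : L2I T, MemBV T v → f u + TGV T α β u ≤ f v + TGV T α β v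

/-- `g` is the weak derivative of `v` on `(0, T)`, both in `L²(0, T)`. -/
structure HasWeakDerivI (T : ℝ) (v g : ℝ → ℝ) : Prop where
  memLp : MemLp v 2 (lebI T)
  memLp_deriv : MemLp g 2 (lebI T)
  byParts : ∀ φ, IsTestFun T φ →
    ∫ x, v x * deriv φ x ∂(lebI T) = -∫ x, g x * φ x ∂(lebI T)

/-- `v ∈ H²(0, T)`. -/
def MemH2 (T : ℝ) (v : ℝ → ℝ) : Prop := ∃ g h, HasWeakDerivI T v g ∧ HasWeakDerivI T g h

/-- `v ∈ H¹₀(0, T)`, the closure of `C_c^∞(0, T)` in `H¹(0, T)`. -/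
def MemH10 (T : ℝ) (v : ℝ → ℝ) : Prop :=
  ∃ g, HasWeakDerivI T v g ∧ ∃ φ : ℕ → ℝ → ℝ, (∀ n, IsTestFun T (φ n)) ∧
    Tendsto (fun n => eLpNorm (fun x => φ n x - v x) 2 (lebI T)) atTop (𝓝 0) ∧
    Tendsto (fun n => eLpNorm (fun x => deriv (φ n) x - g x) 2 (lebI T)) atTop (𝓝 0)

/-- The boundary and sup-norm conditions:
`p ∈ H¹₀`, `P ∈ H² ∩ H¹₀`, `‖p‖_C ≤ α`, `‖P‖_C ≤ β` on `(0, T)`. -/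
def BoundCond (T α β : ℝ) (p P : ℝ → ℝ) : Prop :=
  MemH10 T p ∧ (MemH2 T P ∧ MemH10 T P) ∧
    (∀ x ∈ Ioo 0 T, |p x| ≤ α) ∧ (∀ x ∈ Ioo 0 T, |P x| ≤ β)

/-- `supp μ_± ⊆ {x ∈ (0, T) | q x = ±γ}`, the supports being taken relative to `(0, T)`. -/
def SuppCond (T γ : ℝ) (μ : SignedMeasure ℝ) (q : ℝ → ℝ) : Prop :=
  μ.toJordanDecomposition.posPart.support ∩ Ioo 0 T ⊆ {x | x ∈ Ioo 0 T ∧ q x = γ} ∧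
    μ.toJordanDecomposition.negPart.support ∩ Ioo 0 T ⊆ {x | x ∈ Ioo 0 T ∧ q x = -γ}

/-- `p(x) = ∫₀ˣ ∇f(u)`, with `∇f(u) ∈ L²(0, T)` the Riesz representative of `f'(u)`. -/
def dualSmallP (T : ℝ) (f : L2I T → ℝ) (u : L2I T) (x : ℝ) : ℝ :=
  ∫ t in (0 : ℝ)..x, (∇ f u : L2I T) t

/-- `P(x) = -∫₀ˣ p`. -/
def dualBigP (T : ℝ) (f : L2I T → ℝ) (u : L2I T) (x : ℝ) : ℝ :=
  -∫ t in (0 : ℝ)..x, dualSmallP T f u t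

end

/-! Write g = ∇f(u), p for its primitive and P for minus the primitive of p. If g and p have mean
zero, two integrations by parts give ∫ v g = -∫ p d(Dv - w) - ∫ P dDw for all v, w in BV
(`HasBVDeriv.integral_mul_eq_dual`). If moreover |p| ≤ α and |P| ≤ β, then -∫ v g ≤ α‖Dv - w‖ +
β‖Dw‖ for every w, so -∫ v g ≤ TGV(v). For an optimal w, equality holds exactly when the Jordan
parts of Dv - w and Dw are supported where p = ±α and P = ±β (`suppCond_of_sIntegral_eq`,
`sIntegral_eq_of_suppCond`). Thus (i) and (ii) say that -g is a subgradient of TGV at u.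

Necessity: TGV is sublinear, so minimality and differentiability of f give |∫ v g| ≤ α‖Dv - w‖ +
β‖Dw‖ (`IsTGVMinimizer.abs_integral_mul_le`). Affine v with w = v' make the right side vanish and
force both means to be zero; a step and a ramp starting at y bound p(y) and P(y). The direction -u
yields TGV(u) ≤ -∫ u g, hence equality and (ii). Sufficiency: equality at u, the inequality at every
v and the gradient inequality of f add up.

Two facts connect this with the definitions. A BV function is a.e. a constant plus the distribution
function of its derivative, so Fubini extends integration by parts from test functions to primitives
of mean-zero integrable functions. And for g in L², the primitive of g lies in H¹₀ exactly when g
has mean zero (`memH10_prim`, `integral_eq_zero_of_memH10`). -/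

/-! ### Integrals against signed measures and the total variation norm -/

/-- Bounded continuous functions on the line. -/
structure BddCont (φ : ℝ → ℝ) : Prop where
  continuous : Continuous φ
  bdd : ∃ C, ∀ x, |φ x| ≤ C

theorem BddCont.integrable {φ : ℝ → ℝ} (h : BddCont φ) (a : Measure ℝ) [IsFiniteMeasure a] :
    Integrable φ a := by
  obtain ⟨C, hC⟩ := h.bdd
  exact Integrable.of_bound h.continuous.aestronglyMeasurable C (ae_of_all _ hC)

theorem IsTestFun.bddCont {T : ℝ} {φ : ℝ → ℝ} (h : IsTestFun T φ) : BddCont φ :=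
  ⟨h.smooth.continuous, h.compact.exists_bound_of_continuous h.smooth.continuous⟩

/-- The Jordan decomposition is not additive in μ. Any other decomposition a - b serves equally
well, because a + μ₋ = b + μ₊ as positive measures; linearity of `sIntegral` rests on this. -/
theorem sIntegral_of_eq_sub {μ : SignedMeasure ℝ} {a b : Measure ℝ} [IsFiniteMeasure a]
    [IsFiniteMeasure b] (h : ∀ s, MeasurableSet s → μ s = a.real s - b.real s) {φ : ℝ → ℝ}
    (hφ : BddCont φ) : sIntegral μ φ = ∫ x, φ x ∂a - ∫ x, φ x ∂b := by
  have key : a + μ.toJordanDecomposition.negPart = b + μ.toJordanDecomposition.posPart := by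
    ext s hs
    have h1 := h s hs
    rw [μ.apply_eq_posPart_real_sub_negPart_real hs] at h1
    have h2 : (a + μ.toJordanDecomposition.negPart).real s
        = (b + μ.toJordanDecomposition.posPart).real s := by
      rw [measureReal_add_apply, measureReal_add_apply]
      linarith
    exact (measureReal_eq_measureReal_iff).1 h2
  have h3 := congrArg (fun m : Measure ℝ => ∫ x, φ x ∂m) key
  rw [integral_add_measure (hφ.integrable _) (hφ.integrable _),
    integral_add_measure (hφ.integrable _) (hφ.integrable _)] at h3
  unfold sIntegral
  linarith

theorem sIntegral_add (μ ν : SignedMeasure ℝ) {φ : ℝ → ℝ} (hφ : BddCont φ) :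
    sIntegral (μ + ν) φ = sIntegral μ φ + sIntegral ν φ := by
  rw [sIntegral_of_eq_sub
    (a := μ.toJordanDecomposition.posPart + ν.toJordanDecomposition.posPart)
    (b := μ.toJordanDecomposition.negPart + ν.toJordanDecomposition.negPart) _ hφ,
    integral_add_measure (hφ.integrable _) (hφ.integrable _),
    integral_add_measure (hφ.integrable _) (hφ.integrable _)]
  · unfold sIntegral
    ring
  · intro s hs
    rw [measureReal_add_apply, measureReal_add_apply, add_apply,
      μ.apply_eq_posPart_real_sub_negPart_real hs, ν.apply_eq_posPart_real_sub_negPart_real hs]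
    ring

theorem sIntegral_neg (μ : SignedMeasure ℝ) (φ : ℝ → ℝ) :
    sIntegral (-μ) φ = -sIntegral μ φ := by
  unfold sIntegral
  rw [SignedMeasure.toJordanDecomposition_neg]
  simp

theorem neg_smul_signedMeasure (c : ℝ) (μ : SignedMeasure ℝ) : (-c) • μ = -(c • μ) := by
  ext s _
  rw [smul_apply, neg_apply, smul_apply, neg_smul]

theorem sIntegral_smul (c : ℝ) (μ : SignedMeasure ℝ) (φ : ℝ → ℝ) :
    sIntegral (c • μ) φ = c * sIntegral μ φ := by
  wlog hc : 0 ≤ c generalizing c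
  · have h := this (-c) (by linarith)
    rw [neg_smul_signedMeasure, sIntegral_neg] at h
    linarith
  unfold sIntegral
  rw [SignedMeasure.toJordanDecomposition_smul_real,
    JordanDecomposition.real_smul_posPart_nonneg _ _ hc,
    JordanDecomposition.real_smul_negPart_nonneg _ _ hc, integral_smul_nnreal_measure,
    integral_smul_nnreal_measure]
  simp only [NNReal.smul_def, Real.coe_toNNReal c hc, smul_eq_mul]
  ring

theorem sIntegral_sub (μ ν : SignedMeasure ℝ) {φ : ℝ → ℝ} (hφ : BddCont φ) :
    sIntegral (μ - ν) φ = sIntegral μ φ - sIntegral ν φ := by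
  rw [sub_eq_add_neg, sIntegral_add _ _ hφ, sIntegral_neg, sub_eq_add_neg]

theorem sIntegral_fun_neg (μ : SignedMeasure ℝ) (φ : ℝ → ℝ) :
    sIntegral μ (fun x => -φ x) = -sIntegral μ φ := by
  unfold sIntegral
  rw [integral_neg, integral_neg]
  ring

theorem sIntegral_zero (φ : ℝ → ℝ) : sIntegral 0 φ = 0 := by
  unfold sIntegral
  rw [SignedMeasure.toJordanDecomposition_zero]
  simp

theorem sIntegral_toSignedMeasure (a : Measure ℝ) [IsFiniteMeasure a] {φ : ℝ → ℝ}
    (hφ : BddCont φ) : sIntegral a.toSignedMeasure φ = ∫ x, φ x ∂a := by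
  rw [sIntegral_of_eq_sub (a := a) (b := 0) _ hφ]
  · simp
  · intro s hs
    rw [Measure.toSignedMeasure_apply_measurable hs]
    simp

theorem mNorm_eq (μ : SignedMeasure ℝ) :
    mNorm μ = μ.toJordanDecomposition.posPart.real univ
      + μ.toJordanDecomposition.negPart.real univ := by
  rw [← measureReal_add_apply]
  rfl

theorem mNorm_nonneg (μ : SignedMeasure ℝ) : 0 ≤ mNorm μ := ENNReal.toReal_nonneg

theorem mNorm_zero : mNorm 0 = 0 := by
  simp [mNorm, SignedMeasure.totalVariation_zero]

theorem sub_compl_le_mNorm (μ : SignedMeasure ℝ) {A : Set ℝ} (hA : MeasurableSet A) :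
    μ A - μ Aᶜ ≤ mNorm μ := by
  rw [mNorm_eq, μ.apply_eq_posPart_real_sub_negPart_real hA,
    μ.apply_eq_posPart_real_sub_negPart_real hA.compl,
    ← measureReal_add_measureReal_compl (μ := μ.toJordanDecomposition.posPart) hA,
    ← measureReal_add_measureReal_compl (μ := μ.toJordanDecomposition.negPart) hA]
  have h1 := measureReal_nonneg (μ := μ.toJordanDecomposition.posPart) (s := Aᶜ)
  have h2 := measureReal_nonneg (μ := μ.toJordanDecomposition.negPart) (s := A)
  linarith

/-- A Hahn set attains the upper bound of `sub_compl_le_mNorm`, so the norm is a maximum of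
expressions linear in μ. Subadditivity and homogeneity follow without comparing Jordan
decompositions. -/
theorem exists_mNorm_eq (μ : SignedMeasure ℝ) :
    ∃ A, MeasurableSet A ∧ mNorm μ = μ A - μ Aᶜ := by
  obtain ⟨S, hS, -, -, h1, h2⟩ := μ.toJordanDecomposition.exists_compl_positive_negative
  refine ⟨Sᶜ, hS.compl, ?_⟩
  rw [mNorm_eq, μ.apply_eq_posPart_real_sub_negPart_real hS.compl, compl_compl,
    μ.apply_eq_posPart_real_sub_negPart_real hS,
    ← measureReal_add_measureReal_compl (μ := μ.toJordanDecomposition.posPart) hS,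
    ← measureReal_add_measureReal_compl (μ := μ.toJordanDecomposition.negPart) hS]
  simp [Measure.real, h1, h2]

theorem mNorm_add_le (μ ν : SignedMeasure ℝ) : mNorm (μ + ν) ≤ mNorm μ + mNorm ν := by
  obtain ⟨A, hA, h⟩ := exists_mNorm_eq (μ + ν)
  rw [h, add_apply, add_apply]
  linarith [sub_compl_le_mNorm μ hA, sub_compl_le_mNorm ν hA]

theorem mNorm_smul_le (c : ℝ) (μ : SignedMeasure ℝ) : mNorm (c • μ) ≤ |c| * mNorm μ := by
  obtain ⟨A, hA, h⟩ := exists_mNorm_eq (c • μ)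
  rw [h, smul_apply, smul_apply, smul_eq_mul, smul_eq_mul, ← mul_sub]
  refine (le_abs_self _).trans ?_
  rw [abs_mul]
  refine mul_le_mul_of_nonneg_left ?_ (abs_nonneg c)
  have h1 := sub_compl_le_mNorm μ hA.compl
  rw [compl_compl] at h1
  exact abs_le.2 ⟨by linarith, sub_compl_le_mNorm μ hA⟩

theorem mNorm_dirac_le (y : ℝ) : mNorm (Measure.dirac y).toSignedMeasure ≤ 1 := by
  obtain ⟨A, hA, h⟩ := exists_mNorm_eq (Measure.dirac y).toSignedMeasure
  rw [h, Measure.toSignedMeasure_apply_measurable hA,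
    Measure.toSignedMeasure_apply_measurable hA.compl]
  have h1 := measureReal_nonneg (μ := Measure.dirac y) (s := Aᶜ)
  have h2 : (Measure.dirac y).real A ≤ 1 := measureReal_le_one
  linarith

/-- Turns concentration into a condition visibly stable under linear combinations. Cutting S along a
Hahn set leaves on each piece only one Jordan part, which there equals ±μ. -/
theorem totalVariation_eq_zero_iff (μ : SignedMeasure ℝ) {S : Set ℝ} (hS : MeasurableSet S) :
    μ.totalVariation S = 0 ↔ ∀ A ⊆ S, MeasurableSet A → μ A = 0 := by
  constructor
  · intro h A hA _
    exact μ.null_of_totalVariation_zero (measure_mono_null hA h)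
  · intro h
    obtain ⟨N, hN, -, -, h1, h2⟩ := μ.toJordanDecomposition.exists_compl_positive_negative
    have hp : μ.toJordanDecomposition.posPart (S ∩ Nᶜ) = 0 := by
      have h3 := h _ inter_subset_left (hS.inter hN.compl)
      rw [μ.apply_eq_posPart_real_sub_negPart_real (hS.inter hN.compl), Measure.real, Measure.real,
        measure_mono_null inter_subset_right h2] at h3
      simpa [ENNReal.toReal_eq_zero_iff] using h3
    have hn : μ.toJordanDecomposition.negPart (S ∩ N) = 0 := by
      have h3 := h _ inter_subset_left (hS.inter hN)
      rw [μ.apply_eq_posPart_real_sub_negPart_real (hS.inter hN), Measure.real, Measure.real,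
        measure_mono_null inter_subset_right h1] at h3
      simpa [ENNReal.toReal_eq_zero_iff] using h3
    rw [SignedMeasure.totalVariation, Measure.coe_add, Pi.add_apply, add_eq_zero]
    constructor
    · rw [← measure_inter_add_sdiff S hN, measure_mono_null inter_subset_right h1, sdiff_eq, hp,
        add_zero]
    · rw [← measure_inter_add_sdiff S hN, hn, zero_add]
      exact measure_mono_null (fun x hx => hx.2) h2

/-- The signed measure `μ` lives on `(0, T)`. -/
def LivesOn (T : ℝ) (μ : SignedMeasure ℝ) : Prop := μ.totalVariation (Ioo 0 T)ᶜ = 0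

theorem livesOn_iff {T : ℝ} {μ : SignedMeasure ℝ} :
    LivesOn T μ ↔ ∀ A ⊆ (Ioo 0 T)ᶜ, MeasurableSet A → μ A = 0 :=
  totalVariation_eq_zero_iff μ measurableSet_Ioo.compl

theorem LivesOn.add {T : ℝ} {μ ν : SignedMeasure ℝ} (hμ : LivesOn T μ) (hν : LivesOn T ν) :
    LivesOn T (μ + ν) := by
  rw [livesOn_iff] at *
  intro A hA hA'
  rw [add_apply, hμ A hA hA', hν A hA hA', add_zero]

theorem LivesOn.smul {T : ℝ} {μ : SignedMeasure ℝ} (c : ℝ) (hμ : LivesOn T μ) :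
    LivesOn T (c • μ) := by
  rw [livesOn_iff] at *
  intro A hA hA'
  rw [smul_apply, hμ A hA hA', smul_zero]

theorem LivesOn.sub {T : ℝ} {μ ν : SignedMeasure ℝ} (hμ : LivesOn T μ) (hν : LivesOn T ν) :
    LivesOn T (μ - ν) := by
  have h := hμ.add (hν.smul (-1))
  rwa [neg_smul_signedMeasure, one_smul, ← sub_eq_add_neg] at h

theorem LivesOn.ae_posPart {T : ℝ} {μ : SignedMeasure ℝ} (hμ : LivesOn T μ) :
    ∀ᵐ x ∂μ.toJordanDecomposition.posPart, x ∈ Ioo 0 T := by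
  rw [LivesOn, SignedMeasure.totalVariation, Measure.coe_add, Pi.add_apply, add_eq_zero] at hμ
  exact hμ.1

theorem LivesOn.ae_negPart {T : ℝ} {μ : SignedMeasure ℝ} (hμ : LivesOn T μ) :
    ∀ᵐ x ∂μ.toJordanDecomposition.negPart, x ∈ Ioo 0 T := by
  rw [LivesOn, SignedMeasure.totalVariation, Measure.coe_add, Pi.add_apply, add_eq_zero] at hμ
  exact hμ.2

theorem livesOn_density (T : ℝ) (w : ℝ → ℝ) : LivesOn T (densityI T w) := by
  rw [livesOn_iff]
  intro A hA hA'
  refine Measure.withDensityᵥ_absolutelyContinuous (lebI T) w ?_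
  rw [Measure.toENNRealVectorMeasure_apply_measurable hA', Measure.restrict_apply hA',
    (disjoint_left.2 fun x hx => hA hx).inter_eq, measure_empty]

theorem livesOn_dirac {T y : ℝ} (hy : y ∈ Ioo 0 T) :
    LivesOn T (Measure.dirac y).toSignedMeasure := by
  rw [livesOn_iff]
  intro A hA hA'
  rw [Measure.toSignedMeasure_apply_measurable hA', Measure.real, Measure.dirac_apply' _ hA']
  have : y ∉ A := fun h => hA h hy
  simp [this]

theorem livesOn_zero (T : ℝ) : LivesOn T 0 := by
  simp [LivesOn, SignedMeasure.totalVariation_zero]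

theorem integral_withDensity_ofReal_sub {m : Measure ℝ} {w φ : ℝ → ℝ} (hw : Integrable w m)
    (hφ : BddCont φ) :
    ∫ x, φ x ∂(m.withDensity fun x => ENNReal.ofReal (w x))
      - ∫ x, φ x ∂(m.withDensity fun x => ENNReal.ofReal (-w x)) = ∫ x, w x * φ x ∂m := by
  obtain ⟨C, hC⟩ := hφ.bdd
  have key : ∀ v : ℝ → ℝ, Integrable v m →
      ∫ x, φ x ∂(m.withDensity fun x => ENNReal.ofReal (v x)) = ∫ x, max (v x) 0 * φ x ∂m := by
    intro v hv
    rw [integral_withDensity_eq_integral_toReal_smul₀ hv.aemeasurable.ennreal_ofReal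
      (ae_of_all _ fun x => ENNReal.ofReal_lt_top)]
    simp only [ENNReal.toReal_ofReal', smul_eq_mul]
  have hi : ∀ v : ℝ → ℝ, Integrable v m → Integrable (fun x => max (v x) 0 * φ x) m := by
    intro v hv
    exact hv.pos_part.mul_bdd (c := C) hφ.continuous.aestronglyMeasurable (ae_of_all _ hC)
  rw [key w hw, key (fun x => -w x) hw.neg, ← integral_sub (hi w hw) (hi (fun x => -w x) hw.neg)]
  refine integral_congr_ae (ae_of_all _ fun x => ?_)
  simp only
  rw [← sub_mul]
  congr 1
  rcases le_total 0 (w x) with h | h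
  · rw [max_eq_left h, max_eq_right (by linarith)]; ring
  · rw [max_eq_right h, max_eq_left (by linarith)]; ring

theorem sIntegral_density {T : ℝ} {w φ : ℝ → ℝ} (hw : Integrable w (lebI T)) (hφ : BddCont φ) :
    sIntegral (densityI T w) φ = ∫ x, w x * φ x ∂(lebI T) := by
  rw [← integral_withDensity_ofReal_sub hw hφ]
  have i1 : IsFiniteMeasure ((lebI T).withDensity fun x => ENNReal.ofReal (w x)) :=
    isFiniteMeasure_withDensity_ofReal hw.2
  have i2 : IsFiniteMeasure ((lebI T).withDensity fun x => ENNReal.ofReal (-w x)) :=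
    isFiniteMeasure_withDensity_ofReal hw.neg.2
  refine sIntegral_of_eq_sub (fun s hs => ?_) hφ
  rw [densityI, withDensityᵥ_eq_withDensity_pos_part_sub_withDensity_neg_part hw,
    Measure.toSignedMeasure_sub_apply hs]

/-! ### Pairing with a bounded continuous function: norm bound and equality case -/

theorem sIntegral_le {T γ : ℝ} {μ : SignedMeasure ℝ} (hμ : LivesOn T μ) {φ : ℝ → ℝ}
    (hφ : BddCont φ) (hb : ∀ x ∈ Ioo 0 T, |φ x| ≤ γ) : sIntegral μ φ ≤ γ * mNorm μ := by
  have h1 : ∫ x, φ x ∂μ.toJordanDecomposition.posPart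
      ≤ ∫ _, γ ∂μ.toJordanDecomposition.posPart :=
    integral_mono_ae (hφ.integrable _) (integrable_const _)
      (hμ.ae_posPart.mono fun x hx => (abs_le.1 (hb x hx)).2)
  have h2 : ∫ _, -γ ∂μ.toJordanDecomposition.negPart
      ≤ ∫ x, φ x ∂μ.toJordanDecomposition.negPart :=
    integral_mono_ae (integrable_const _) (hφ.integrable _)
      (hμ.ae_negPart.mono fun x hx => (abs_le.1 (hb x hx)).1)
  rw [integral_const, smul_eq_mul] at h1 h2
  rw [mNorm_eq]
  unfold sIntegral
  linarith

/-- Equality makes the integrals of γ - φ over μ₊ and of γ + φ over μ₋, both nonnegative, sum to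
zero. Hence φ = ±γ a.e., and by continuity these level sets are closed, so they contain the
supports. -/
theorem suppCond_of_sIntegral_eq {T γ : ℝ} {μ : SignedMeasure ℝ} (hμ : LivesOn T μ) {φ : ℝ → ℝ}
    (hφ : BddCont φ) (hb : ∀ x ∈ Ioo 0 T, |φ x| ≤ γ) (h : sIntegral μ φ = γ * mNorm μ) :
    SuppCond T γ μ φ := by
  have n1 : 0 ≤ᵐ[μ.toJordanDecomposition.posPart] fun x => γ - φ x :=
    hμ.ae_posPart.mono fun x hx => by
      have := (abs_le.1 (hb x hx)).2
      simp only [Pi.zero_apply]; linarith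
  have n2 : 0 ≤ᵐ[μ.toJordanDecomposition.negPart] fun x => γ + φ x :=
    hμ.ae_negPart.mono fun x hx => by
      have := (abs_le.1 (hb x hx)).1
      simp only [Pi.zero_apply]; linarith
  have e1 : ∫ x, (γ - φ x) ∂μ.toJordanDecomposition.posPart
      = γ * μ.toJordanDecomposition.posPart.real univ
        - ∫ x, φ x ∂μ.toJordanDecomposition.posPart := by
    rw [integral_sub (integrable_const _) (hφ.integrable _), integral_const, smul_eq_mul, mul_comm]
  have e2 : ∫ x, (γ + φ x) ∂μ.toJordanDecomposition.negPart
      = γ * μ.toJordanDecomposition.negPart.real univ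
        + ∫ x, φ x ∂μ.toJordanDecomposition.negPart := by
    rw [integral_add (integrable_const _) (hφ.integrable _), integral_const, smul_eq_mul, mul_comm]
  have p1 := integral_nonneg_of_ae n1
  have p2 := integral_nonneg_of_ae n2
  rw [mNorm_eq] at h
  unfold sIntegral at h
  have z1 : ∫ x, (γ - φ x) ∂μ.toJordanDecomposition.posPart = 0 := by linarith
  have z2 : ∫ x, (γ + φ x) ∂μ.toJordanDecomposition.negPart = 0 := by linarith
  rw [integral_eq_zero_iff_of_nonneg_ae n1 ((integrable_const _).sub (hφ.integrable _))] at z1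
  rw [integral_eq_zero_iff_of_nonneg_ae n2 ((integrable_const _).add (hφ.integrable _))] at z2
  have c1 : μ.toJordanDecomposition.posPart.support ⊆ {x | φ x = γ} :=
    Measure.support_subset_of_isClosed (isClosed_eq hφ.continuous continuous_const)
      (z1.mono fun x hx => by simp only [Pi.zero_apply] at hx; linarith)
  have c2 : μ.toJordanDecomposition.negPart.support ⊆ {x | φ x = -γ} :=
    Measure.support_subset_of_isClosed (isClosed_eq hφ.continuous continuous_const)
      (z2.mono fun x hx => by simp only [Pi.zero_apply] at hx; linarith)
  exact ⟨fun x hx => ⟨hx.2, c1 hx.1⟩, fun x hx => ⟨hx.2, c2 hx.1⟩⟩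

theorem sIntegral_eq_of_suppCond {T γ : ℝ} {μ : SignedMeasure ℝ} (hμ : LivesOn T μ) {φ : ℝ → ℝ}
    (h : SuppCond T γ μ φ) : sIntegral μ φ = γ * mNorm μ := by
  have h1 : ∫ x, φ x ∂μ.toJordanDecomposition.posPart
      = ∫ _, γ ∂μ.toJordanDecomposition.posPart := by
    refine integral_congr_ae ?_
    filter_upwards [hμ.ae_posPart, Measure.support_mem_ae] with x hx hx'
    exact (h.1 ⟨hx', hx⟩).2
  have h2 : ∫ x, φ x ∂μ.toJordanDecomposition.negPart
      = ∫ _, -γ ∂μ.toJordanDecomposition.negPart := by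
    refine integral_congr_ae ?_
    filter_upwards [hμ.ae_negPart, Measure.support_mem_ae] with x hx hx'
    exact (h.2 ⟨hx', hx⟩).2
  unfold sIntegral
  rw [h1, h2, mNorm_eq, integral_const, integral_const, smul_eq_mul, smul_eq_mul]
  ring

theorem SuppCond.congr {T γ : ℝ} {μ : SignedMeasure ℝ} {φ ψ : ℝ → ℝ} (h : SuppCond T γ μ φ)
    (e : ∀ x ∈ Ioo 0 T, φ x = ψ x) : SuppCond T γ μ ψ :=
  ⟨fun x hx => ⟨hx.2, (e x hx.2).symm.trans (h.1 hx).2⟩,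
    fun x hx => ⟨hx.2, (e x hx.2).symm.trans (h.2 hx).2⟩⟩

/-! ### Primitives -/

/-- The primitive of `g` on `(0, T)` vanishing at `0`. -/
noncomputable def prim (T : ℝ) (g : ℝ → ℝ) (x : ℝ) : ℝ := ∫ t in Iic x, g t ∂(lebI T)

/-- Integrating over `Iic x` against `lebI T` makes the primitive bounded and continuous on the
whole line, hence integrable for every finite measure. On [0, T] nothing changes. -/
theorem prim_eq_intervalIntegral {T x : ℝ} (g : ℝ → ℝ) (h0 : 0 ≤ x) (hT : x ≤ T) :
    prim T g x = ∫ t in (0 : ℝ)..x, g t := by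
  rw [prim, Measure.restrict_restrict measurableSet_Iic, intervalIntegral.integral_of_le h0]
  refine setIntegral_congr_set ?_
  have e : (Iic x ∩ Ioo 0 T : Set ℝ) =ᵐ[volume] (Iic x ∩ Ioc 0 T : Set ℝ) :=
    ae_eq_set_inter (ae_eq_refl _) Ioo_ae_eq_Ioc
  have e' : Iic x ∩ Ioc 0 T = Ioc 0 x := by
    ext t
    simp only [mem_inter_iff, mem_Iic, mem_Ioc]
    constructor
    · rintro ⟨h1, h2, -⟩; exact ⟨h2, h1⟩
    · rintro ⟨h1, h2⟩; exact ⟨h2, h1, h2.trans hT⟩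
  rwa [e'] at e

theorem prim_right {T : ℝ} (g : ℝ → ℝ) : prim T g T = ∫ t, g t ∂(lebI T) := by
  rw [prim, Measure.restrict_restrict measurableSet_Iic,
    inter_eq_right.2 (Ioo_subset_Iio_self.trans Iio_subset_Iic_self)]

theorem continuous_prim {T : ℝ} {g : ℝ → ℝ} (hg : Integrable g (lebI T)) :
    Continuous (prim T g) := by
  have h : prim T g = fun x => prim T g 0 + ∫ t in (0 : ℝ)..x, g t ∂(lebI T) := by
    funext x
    rw [← intervalIntegral.integral_Iic_sub_Iic hg.integrableOn hg.integrableOn]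
    simp only [prim]
    ring
  rw [h]
  exact continuous_const.add
    (intervalIntegral.continuous_primitive (fun _ _ => hg.intervalIntegrable) 0)

theorem abs_prim_le {T : ℝ} {g : ℝ → ℝ} (hg : Integrable g (lebI T)) (x : ℝ) :
    |prim T g x| ≤ ∫ t, |g t| ∂(lebI T) :=
  (abs_integral_le_integral_abs).trans
    (setIntegral_le_integral hg.abs (ae_of_all _ fun _ => abs_nonneg _))

theorem bddCont_prim {T : ℝ} {g : ℝ → ℝ} (hg : Integrable g (lebI T)) : BddCont (prim T g) :=
  ⟨continuous_prim hg, _, abs_prim_le hg⟩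

theorem BddCont.neg {φ : ℝ → ℝ} (h : BddCont φ) : BddCont fun x => -φ x :=
  ⟨h.continuous.neg, h.bdd.imp fun C hC x => by rw [abs_neg]; exact hC x⟩

/-! ### Distribution functions of measures -/

theorem measurable_measureReal_Iic (a : Measure ℝ) [IsFiniteMeasure a] :
    Measurable fun x => a.real (Iic x) :=
  Monotone.measurable fun _ _ h => measureReal_mono (Iic_subset_Iic.2 h)

theorem integrable_measureReal_Iic_mul {T : ℝ} (a : Measure ℝ) [IsFiniteMeasure a] {g : ℝ → ℝ}
    (hg : Integrable g (lebI T)) : Integrable (fun x => a.real (Iic x) * g x) (lebI T) :=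
  hg.bdd_mul (c := a.real univ) (measurable_measureReal_Iic a).aestronglyMeasurable
    (ae_of_all _ fun x => by
      rw [Real.norm_of_nonneg measureReal_nonneg]
      exact measureReal_mono (subset_univ _))

/-- Fubini on the half-plane s ≤ x; the inner integral on the right is that of g over [s, ∞), the
point s being negligible. -/
theorem integral_measureReal_Iic_mul {T : ℝ} (a : Measure ℝ) [IsFiniteMeasure a] {g : ℝ → ℝ}
    (hg : Integrable g (lebI T)) :
    ∫ x, a.real (Iic x) * g x ∂(lebI T)
      = ∫ s, (∫ t, g t ∂(lebI T) - prim T g s) ∂a := by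
  have hm : MeasurableSet {z : ℝ × ℝ | z.2 ≤ z.1} := measurableSet_le measurable_snd measurable_fst
  have hint : Integrable (Function.uncurry fun x s => (Iic x).indicator (fun _ => g x) s)
      ((lebI T).prod a) := by
    have h1 : (Function.uncurry fun x s => (Iic x).indicator (fun _ => g x) s)
        = {z : ℝ × ℝ | z.2 ≤ z.1}.indicator fun z => g z.1 := by
      funext z
      simp only [Function.uncurry, indicator, mem_Iic, mem_ofPred_eq]
    rw [h1]
    exact (hg.comp_fst a).indicator hm
  have h2 := integral_integral_swap hint
  calc ∫ x, a.real (Iic x) * g x ∂(lebI T)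
      = ∫ x, ∫ s, (Iic x).indicator (fun _ => g x) s ∂a ∂(lebI T) := by
        refine integral_congr_ae (ae_of_all _ fun x => ?_)
        simp only
        rw [integral_indicator measurableSet_Iic, setIntegral_const, smul_eq_mul]
    _ = ∫ s, ∫ x, (Iic x).indicator (fun _ => g x) s ∂(lebI T) ∂a := h2
    _ = _ := by
        refine integral_congr_ae (ae_of_all _ fun s => ?_)
        simp only
        have h3 : ∀ x, (Iic x).indicator (fun _ => g x) s = (Ici s).indicator g x := by
          intro x
          simp only [indicator, mem_Iic, mem_Ici]
        simp only [h3]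
        rw [integral_indicator measurableSet_Ici, prim, integral_Iic_eq_integral_Iio,
          ← integral_add_compl (measurableSet_Iio (a := s)) hg, compl_Iio]
        ring

theorem signedMeasure_Iic_eq (μ : SignedMeasure ℝ) (x : ℝ) :
    μ (Iic x) = μ.toJordanDecomposition.posPart.real (Iic x)
      - μ.toJordanDecomposition.negPart.real (Iic x) :=
  μ.apply_eq_posPart_real_sub_negPart_real measurableSet_Iic

theorem integrable_signedMeasure_Iic_mul {T : ℝ} (μ : SignedMeasure ℝ) {g : ℝ → ℝ}
    (hg : Integrable g (lebI T)) : Integrable (fun x => μ (Iic x) * g x) (lebI T) := by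
  simp only [signedMeasure_Iic_eq, sub_mul]
  exact (integrable_measureReal_Iic_mul _ hg).sub (integrable_measureReal_Iic_mul _ hg)

theorem integrable_signedMeasure_Iic (T : ℝ) (μ : SignedMeasure ℝ) :
    Integrable (fun x => μ (Iic x)) (lebI T) := by
  simpa using integrable_signedMeasure_Iic_mul μ (integrable_const (μ := lebI T) (1 : ℝ))

theorem integral_signedMeasure_Iic_mul {T : ℝ} (μ : SignedMeasure ℝ) {g : ℝ → ℝ}
    (hg : Integrable g (lebI T)) (h0 : ∫ t, g t ∂(lebI T) = 0) :
    ∫ x, μ (Iic x) * g x ∂(lebI T) = -sIntegral μ (prim T g) := by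
  simp only [signedMeasure_Iic_eq, sub_mul]
  rw [integral_sub (integrable_measureReal_Iic_mul _ hg) (integrable_measureReal_Iic_mul _ hg),
    integral_measureReal_Iic_mul _ hg, integral_measureReal_Iic_mul _ hg, h0]
  simp only [zero_sub, integral_neg]
  unfold sIntegral
  ring

/-! ### Test functions -/

theorem IsTestFun.eq_zero {T : ℝ} {φ : ℝ → ℝ} (h : IsTestFun T φ) {x : ℝ} (hx : x ∉ Ioo 0 T) :
    φ x = 0 :=
  image_eq_zero_of_notMem_tsupport fun h' => hx (h.supp h')

theorem IsTestFun.deriv {T : ℝ} {φ : ℝ → ℝ} (h : IsTestFun T φ) : IsTestFun T (deriv φ) :=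
  ⟨(contDiff_infty_iff_deriv.1 h.smooth).2, h.compact.deriv,
    (tsupport_deriv_subset (f := φ)).trans h.supp⟩

theorem IsTestFun.integrable {T : ℝ} {φ : ℝ → ℝ} (h : IsTestFun T φ) : Integrable φ (lebI T) :=
  h.bddCont.integrable _

theorem IsTestFun.add {T : ℝ} {φ ψ : ℝ → ℝ} (h : IsTestFun T φ) (h' : IsTestFun T ψ) :
    IsTestFun T (φ + ψ) :=
  ⟨h.smooth.add h'.smooth, h.compact.add h'.compact,
    (tsupport_add φ ψ).trans (union_subset h.supp h'.supp)⟩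

theorem IsTestFun.smul {T : ℝ} {φ : ℝ → ℝ} (c : ℝ) (h : IsTestFun T φ) : IsTestFun T (c • φ) :=
  ⟨h.smooth.const_smul c, h.compact.smul_left (f := fun _ => c),
    (tsupport_smul_subset_right (fun _ => c) φ).trans h.supp⟩

theorem isTestFun_zero (T : ℝ) : IsTestFun T 0 :=
  ⟨contDiff_const, HasCompactSupport.zero, by simp [tsupport]⟩

theorem IsTestFun.prim_deriv {T : ℝ} {φ : ℝ → ℝ} (h : IsTestFun T φ) {x : ℝ}
    (h0 : 0 ≤ x) (hT : x ≤ T) : prim T (_root_.deriv φ) x = φ x := by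
  rw [prim_eq_intervalIntegral _ h0 hT, intervalIntegral.integral_deriv_eq_sub
    (fun t _ => (h.smooth.differentiable (by simp)) t)
    (h.deriv.smooth.continuous.intervalIntegrable _ _), h.eq_zero (x := 0) (by simp), sub_zero]

theorem IsTestFun.integral_deriv {T : ℝ} (hT : 0 < T) {φ : ℝ → ℝ} (h : IsTestFun T φ) :
    ∫ t, _root_.deriv φ t ∂(lebI T) = 0 := by
  rw [← prim_right, h.prim_deriv hT.le le_rfl, h.eq_zero (by simp)]

theorem integrable_mul_isTestFun {T : ℝ} {h ψ : ℝ → ℝ} (hh : Integrable h (lebI T))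
    (hψ : IsTestFun T ψ) : Integrable (fun x => h x * ψ x) (lebI T) := by
  obtain ⟨C, hC⟩ := hψ.bddCont.bdd
  exact hh.mul_bdd (c := C) hψ.smooth.continuous.aestronglyMeasurable (ae_of_all _ hC)

theorem exists_isTestFun_integral_eq_one {T : ℝ} (hT : 0 < T) :
    ∃ θ, IsTestFun T θ ∧ ∫ t, θ t ∂(lebI T) = 1 := by
  let b : ContDiffBump (T / 2) := ⟨T / 8, T / 4, by linarith, by linarith⟩
  have hs : tsupport (b.normed volume) ⊆ Ioo 0 T := by
    rw [b.tsupport_normed_eq]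
    intro x hx
    rw [Metric.mem_closedBall, Real.dist_eq, abs_le] at hx
    have : b.rOut = T / 4 := rfl
    constructor <;> linarith [hx.1, hx.2]
  refine ⟨b.normed volume, ⟨b.contDiff_normed, b.hasCompactSupport_normed, hs⟩, ?_⟩
  rw [setIntegral_eq_integral_of_forall_compl_eq_zero, b.integral_normed]
  intro x hx
  exact image_eq_zero_of_notMem_tsupport fun h' => hx (hs h')

theorem exists_Icc_of_isCompact_subset_Ioo {T : ℝ} {K : Set ℝ} (hT : 0 < T) (hK : IsCompact K)
    (h : K ⊆ Ioo 0 T) : ∃ a b, 0 < a ∧ b < T ∧ K ⊆ Icc a b := by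
  rcases K.eq_empty_or_nonempty with rfl | hne
  · exact ⟨T / 2, T / 2, by linarith, by linarith, empty_subset _⟩
  · obtain ⟨a, ha⟩ := hK.exists_isLeast hne
    obtain ⟨b, hb⟩ := hK.exists_isGreatest hne
    exact ⟨a, b, (h ha.1).1, (h hb.1).2, fun x hx => ⟨ha.2 hx, hb.2 hx⟩⟩

/-- The primitive vanishes to the left of the support of η, and to the right of it because the total
integral is zero. -/
theorem IsTestFun.exists_deriv_eq {T : ℝ} (hT : 0 < T) {η : ℝ → ℝ} (h : IsTestFun T η)
    (h0 : ∫ t, η t ∂(lebI T) = 0) : ∃ φ, IsTestFun T φ ∧ _root_.deriv φ = η := by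
  obtain ⟨a, b, ha, hb, hab⟩ := exists_Icc_of_isCompact_subset_Ioo hT h.compact h.supp
  have hc := h.smooth.continuous
  have hz : ∀ x ∉ Icc a b, η x = 0 := fun x hx =>
    image_eq_zero_of_notMem_tsupport fun h' => hx (hab h')
  have hd : ∀ x, HasDerivAt (fun x => ∫ t in (0 : ℝ)..x, η t) (η x) x := fun x =>
    intervalIntegral.integral_hasDerivAt_right (hc.intervalIntegrable _ _)
      hc.stronglyMeasurable.stronglyMeasurableAtFilter hc.continuousAt
  have hd' : _root_.deriv (fun x => ∫ t in (0 : ℝ)..x, η t) = η := funext fun x => (hd x).deriv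
  have hsupp : tsupport (fun x => ∫ t in (0 : ℝ)..x, η t) ⊆ Icc a b := by
    refine closure_minimal (fun x hx => ?_) isClosed_Icc
    by_contra hx'
    refine hx ?_
    rw [mem_Icc, not_and_or, not_le, not_le] at hx'
    rcases hx' with hx' | hx'
    · have : EqOn η (fun _ => 0) (uIcc 0 x) := fun t ht => hz t fun h' => by
        rcases mem_uIcc.1 ht with h2 | h2
        · linarith [h2.2, h'.1]
        · linarith [h2.2, h'.1]
      simp only
      rw [intervalIntegral.integral_congr this, intervalIntegral.integral_zero]
    · have : EqOn η (fun _ => 0) (uIcc x T) := fun t ht => hz t fun h' => by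
        rcases mem_uIcc.1 ht with h2 | h2
        · linarith [h2.1, h'.2]
        · linarith [h2.1, h'.2]
      rw [← prim_right, prim_eq_intervalIntegral η hT.le le_rfl,
        ← intervalIntegral.integral_add_adjacent_intervals (hc.intervalIntegrable 0 x)
          (hc.intervalIntegrable x T), intervalIntegral.integral_congr this,
        intervalIntegral.integral_zero, add_zero] at h0
      exact h0
  refine ⟨_, ⟨contDiff_infty_iff_deriv.2 ⟨fun x => (hd x).differentiableAt, ?_⟩,
    isCompact_Icc.of_isClosed_subset (isClosed_tsupport _) hsupp,
    hsupp.trans fun x hx => ⟨ha.trans_le hx.1, hx.2.trans_lt hb⟩⟩, hd'⟩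
  rw [hd']
  exact h.smooth

theorem ae_eq_zero_of_forall_isTestFun {T : ℝ} {h : ℝ → ℝ} (hh : Integrable h (lebI T))
    (H : ∀ φ, IsTestFun T φ → ∫ x, h x * φ x ∂(lebI T) = 0) : h =ᵐ[lebI T] 0 := by
  have h1 := isOpen_Ioo.ae_eq_zero_of_integral_contDiff_smul_eq_zero (μ := volume)
    (f := h) (U := Ioo 0 T) (IntegrableOn.locallyIntegrableOn hh) (fun φ h1 h2 h3 => by
      have h4 := H φ ⟨h1, h2, h3⟩
      rw [setIntegral_eq_integral_of_forall_compl_eq_zero] at h4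
      · simpa only [smul_eq_mul, mul_comm] using h4
      · intro x hx
        rw [image_eq_zero_of_notMem_tsupport fun h' => hx (h3 h'), mul_zero])
  exact (ae_restrict_iff' measurableSet_Ioo).2 h1

/-- The du Bois-Reymond lemma. -/
theorem exists_ae_eq_const_of_forall_deriv {T : ℝ} (hT : 0 < T) {h : ℝ → ℝ}
    (hh : Integrable h (lebI T))
    (H : ∀ φ, IsTestFun T φ → ∫ x, h x * deriv φ x ∂(lebI T) = 0) :
    ∃ c : ℝ, h =ᵐ[lebI T] fun _ => c := by
  obtain ⟨θ, hθ, hθ1⟩ := exists_isTestFun_integral_eq_one hT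
  have hmul : ∀ ψ, IsTestFun T ψ → Integrable (fun x => h x * ψ x) (lebI T) :=
    fun ψ hψ => integrable_mul_isTestFun hh hψ
  set c := ∫ x, h x * θ x ∂(lebI T) with hc
  refine ⟨c, ?_⟩
  have key : (fun x => h x - c) =ᵐ[lebI T] 0 := by
    refine ae_eq_zero_of_forall_isTestFun (hh.sub (integrable_const c)) fun ψ hψ => ?_
    set m := ∫ x, ψ x ∂(lebI T) with hm
    -- Subtracting from ψ its mass times θ gives mean zero, hence the derivative of a test function.
    obtain ⟨φ, hφ, e⟩ := (hψ.add (hθ.smul (-m))).exists_deriv_eq hT (by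
      simp only [Pi.add_apply, Pi.smul_apply, smul_eq_mul]
      rw [integral_add hψ.integrable (hθ.integrable.const_mul _), integral_const_mul, hθ1, ← hm]
      ring)
    have h1 := H φ hφ
    rw [e] at h1
    have h2 : ∀ x, h x * (ψ + -m • θ) x = h x * ψ x - m * (h x * θ x) := fun x => by
      simp only [Pi.add_apply, Pi.smul_apply, smul_eq_mul]; ring
    simp only [h2] at h1
    rw [integral_sub (hmul ψ hψ) ((hmul θ hθ).const_mul m), integral_const_mul, ← hc] at h1
    simp only [sub_mul]
    rw [integral_sub (hmul ψ hψ) (hψ.integrable.const_mul c), integral_const_mul, ← hm]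
    linarith
  filter_upwards [key] with x hx
  simp only [Pi.zero_apply] at hx
  linarith

/-! ### Functions of bounded variation -/

theorem sIntegral_prim_deriv {T : ℝ} {μ : SignedMeasure ℝ} (hμ : LivesOn T μ) {φ : ℝ → ℝ}
    (hφ : IsTestFun T φ) : sIntegral μ (prim T (deriv φ)) = sIntegral μ φ := by
  unfold sIntegral
  congr 1
  · exact integral_congr_ae (hμ.ae_posPart.mono fun x hx => hφ.prim_deriv hx.1.le hx.2.le)
  · exact integral_congr_ae (hμ.ae_negPart.mono fun x hx => hφ.prim_deriv hx.1.le hx.2.le)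

theorem hasBVDeriv_Iic {T : ℝ} (hT : 0 < T) {μ : SignedMeasure ℝ} (hμ : LivesOn T μ) :
    HasBVDeriv T (fun x => μ (Iic x)) μ :=
  ⟨integrable_signedMeasure_Iic T μ, hμ, fun φ hφ => by
    rw [integral_signedMeasure_Iic_mul μ hφ.deriv.integrable (hφ.integral_deriv hT),
      sIntegral_prim_deriv hμ hφ]⟩

theorem HasBVDeriv.congr {T : ℝ} {u v : ℝ → ℝ} {μ : SignedMeasure ℝ} (h : HasBVDeriv T u μ)
    (e : u =ᵐ[lebI T] v) : HasBVDeriv T v μ :=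
  ⟨h.integrable.congr e, h.concentrated, fun φ hφ => by
    rw [← h.byParts φ hφ]
    exact integral_congr_ae (e.mono fun x hx => by simp only [hx])⟩

theorem HasBVDeriv.add {T : ℝ} {u v : ℝ → ℝ} {μ ν : SignedMeasure ℝ} (h : HasBVDeriv T u μ)
    (h' : HasBVDeriv T v ν) : HasBVDeriv T (fun x => u x + v x) (μ + ν) :=
  ⟨h.integrable.add h'.integrable, LivesOn.add h.concentrated h'.concentrated, fun φ hφ => by
    simp only [add_mul]
    rw [integral_add (integrable_mul_isTestFun h.integrable hφ.deriv)
      (integrable_mul_isTestFun h'.integrable hφ.deriv), h.byParts φ hφ, h'.byParts φ hφ,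
      sIntegral_add _ _ hφ.bddCont]
    ring⟩

theorem HasBVDeriv.smul {T : ℝ} {u : ℝ → ℝ} {μ : SignedMeasure ℝ} (c : ℝ) (h : HasBVDeriv T u μ) :
    HasBVDeriv T (fun x => c * u x) (c • μ) :=
  ⟨h.integrable.const_mul c, LivesOn.smul c h.concentrated, fun φ hφ => by
    simp only [mul_assoc]
    rw [integral_const_mul, h.byParts φ hφ, sIntegral_smul]
    ring⟩

/-- The difference of u and the distribution function of μ has zero distributional derivative, so du
Bois-Reymond applies. -/
theorem HasBVDeriv.exists_ae_eq {T : ℝ} (hT : 0 < T) {u : ℝ → ℝ} {μ : SignedMeasure ℝ}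
    (h : HasBVDeriv T u μ) : ∃ c : ℝ, u =ᵐ[lebI T] fun x => c + μ (Iic x) := by
  have hI := hasBVDeriv_Iic hT h.concentrated
  obtain ⟨c, hc⟩ := exists_ae_eq_const_of_forall_deriv hT (h.integrable.sub hI.integrable)
    fun φ hφ => by
      simp only [Pi.sub_apply, sub_mul]
      rw [integral_sub (integrable_mul_isTestFun h.integrable hφ.deriv)
        (integrable_mul_isTestFun hI.integrable hφ.deriv), h.byParts φ hφ, hI.byParts φ hφ,
        sub_self]
  refine ⟨c, ?_⟩
  filter_upwards [hc] with x hx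
  simp only [Pi.sub_apply] at hx
  linarith

/-- Integration by parts for `u ∈ BV(0, T)` against a primitive vanishing at both ends. -/
theorem HasBVDeriv.integral_mul {T : ℝ} (hT : 0 < T) {u : ℝ → ℝ} {μ : SignedMeasure ℝ}
    (h : HasBVDeriv T u μ) {g : ℝ → ℝ} (hg : Integrable g (lebI T))
    (h0 : ∫ t, g t ∂(lebI T) = 0) :
    ∫ x, u x * g x ∂(lebI T) = -sIntegral μ (prim T g) := by
  obtain ⟨c, hc⟩ := h.exists_ae_eq hT
  rw [← integral_signedMeasure_Iic_mul μ hg h0,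
    integral_congr_ae (g := fun x => c * g x + μ (Iic x) * g x)
      (hc.mono fun x hx => by simp only [hx]; ring),
    integral_add (hg.const_mul c) (integrable_signedMeasure_Iic_mul μ hg), integral_const_mul, h0,
    mul_zero, zero_add]

theorem hasBVDeriv_prim {T : ℝ} (hT : 0 < T) {g : ℝ → ℝ} (hg : Integrable g (lebI T)) :
    HasBVDeriv T (prim T g) (densityI T g) := by
  refine (hasBVDeriv_Iic hT (livesOn_density T g)).congr (ae_of_all _ fun x => ?_)
  exact withDensityᵥ_apply hg measurableSet_Iic

theorem hasBVDeriv_const {T : ℝ} (hT : 0 < T) (c : ℝ) : HasBVDeriv T (fun _ => c) 0 :=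
  ⟨integrable_const c, livesOn_zero T, fun φ hφ => by
    rw [integral_const_mul, hφ.integral_deriv hT, sIntegral_zero, mul_zero, neg_zero]⟩

/-! ### Sobolev functions -/

theorem BddCont.memLp {φ : ℝ → ℝ} (h : BddCont φ) (p : ℝ≥0∞) (a : Measure ℝ) [IsFiniteMeasure a] :
    MemLp φ p a := by
  obtain ⟨C, hC⟩ := h.bdd
  exact MemLp.of_bound h.continuous.aestronglyMeasurable C (ae_of_all _ hC)

theorem memLp_two_integrable {T : ℝ} {g : ℝ → ℝ} (hg : MemLp g 2 (lebI T)) :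
    Integrable g (lebI T) :=
  hg.integrable (by norm_num)

theorem hasWeakDerivI_prim {T : ℝ} (hT : 0 < T) {g : ℝ → ℝ} (hg : MemLp g 2 (lebI T)) :
    HasWeakDerivI T (prim T g) g :=
  have hi := memLp_two_integrable hg
  ⟨(bddCont_prim hi).memLp _ _, hg, fun φ hφ => by
    rw [(hasBVDeriv_prim hT hi).byParts φ hφ, sIntegral_density hi hφ.bddCont]⟩

theorem HasWeakDerivI.neg {T : ℝ} {v g : ℝ → ℝ} (h : HasWeakDerivI T v g) :
    HasWeakDerivI T (fun x => -v x) (fun x => -g x) :=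
  ⟨h.memLp.neg, h.memLp_deriv.neg, fun φ hφ => by
    simp only [neg_mul, integral_neg]
    rw [h.byParts φ hφ]⟩

theorem HasWeakDerivI.congr {T : ℝ} {v v' g : ℝ → ℝ} (h : HasWeakDerivI T v g)
    (e : v =ᵐ[lebI T] v') : HasWeakDerivI T v' g :=
  ⟨h.memLp.ae_eq e, h.memLp_deriv, fun φ hφ => by
    rw [← h.byParts φ hφ]
    exact integral_congr_ae (e.mono fun x hx => by simp only [hx])⟩

theorem HasWeakDerivI.ae_unique {T : ℝ} {v g h : ℝ → ℝ} (hg : HasWeakDerivI T v g)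
    (hh : HasWeakDerivI T v h) : g =ᵐ[lebI T] h := by
  have ig := memLp_two_integrable hg.memLp_deriv
  have ih := memLp_two_integrable hh.memLp_deriv
  have key : (fun x => g x - h x) =ᵐ[lebI T] 0 := by
    refine ae_eq_zero_of_forall_isTestFun (ig.sub ih) fun φ hφ => ?_
    simp only [sub_mul]
    rw [integral_sub (integrable_mul_isTestFun ig hφ) (integrable_mul_isTestFun ih hφ)]
    linarith [hg.byParts φ hφ, hh.byParts φ hφ]
  filter_upwards [key] with x hx
  simp only [Pi.zero_apply] at hx
  linarith

theorem MemH10.congr {T : ℝ} {v v' : ℝ → ℝ} (h : MemH10 T v) (e : v =ᵐ[lebI T] v') :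
    MemH10 T v' := by
  obtain ⟨g, hg, φ, hφ, h1, h2⟩ := h
  refine ⟨g, hg.congr e, φ, hφ, h1.congr fun n => eLpNorm_congr_ae ?_, h2⟩
  exact e.mono fun x hx => by simp only [hx]

theorem MemH10.neg {T : ℝ} {v : ℝ → ℝ} (h : MemH10 T v) : MemH10 T fun x => -v x := by
  obtain ⟨g, hg, φ, hφ, h1, h2⟩ := h
  refine ⟨_, hg.neg, fun n => (-1 : ℝ) • φ n, fun n => (hφ n).smul _,
    h1.congr fun n => ?_, h2.congr fun n => ?_⟩
  · rw [← eLpNorm_neg]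
    refine eLpNorm_congr_ae (ae_of_all _ fun x => ?_)
    simp only [Pi.neg_apply, Pi.smul_apply, smul_eq_mul]
    ring
  · rw [← eLpNorm_neg]
    refine eLpNorm_congr_ae (ae_of_all _ fun x => ?_)
    have hd : deriv ((-1 : ℝ) • φ n) x = -deriv (φ n) x := by
      rw [neg_one_smul]
      exact deriv.neg
    simp only [Pi.neg_apply]
    rw [hd]
    ring

theorem MemH2.congr {T : ℝ} {v v' : ℝ → ℝ} (h : MemH2 T v) (e : v =ᵐ[lebI T] v') :
    MemH2 T v' := by
  obtain ⟨g, k, hg, hk⟩ := h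
  exact ⟨g, k, hg.congr e, hk⟩

theorem eLpNorm_one_le_eLpNorm_two {T : ℝ} {h : ℝ → ℝ} (hh : AEStronglyMeasurable h (lebI T)) :
    eLpNorm h 1 (lebI T) ≤ eLpNorm h 2 (lebI T) * (lebI T) univ ^ (1 / 2 : ℝ) := by
  have h1 := eLpNorm_le_eLpNorm_mul_rpow_measure_univ (p := 1) (q := 2) (by norm_num) hh
  norm_num at h1 ⊢
  exact h1

theorem tendsto_mul_const_zero {c : ℝ≥0∞} (hc : c ≠ ⊤) {s : ℕ → ℝ≥0∞}
    (hs : Tendsto s atTop (𝓝 0)) : Tendsto (fun n => s n * c) atTop (𝓝 0) := by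
  simpa using ENNReal.Tendsto.mul_const hs (Or.inr hc)

theorem rpow_lebI_univ_ne_top (T : ℝ) : (lebI T) univ ^ (1 / 2 : ℝ) ≠ ⊤ :=
  ENNReal.rpow_ne_top_of_nonneg (by norm_num) (measure_ne_top _ _)

/-- Derivatives of test functions have mean zero, and the mean is continuous for L² convergence on a
bounded interval. -/
theorem integral_eq_zero_of_memH10 {T : ℝ} (hT : 0 < T) {v g : ℝ → ℝ} (h : MemH10 T v)
    (hg : HasWeakDerivI T v g) : ∫ x, g x ∂(lebI T) = 0 := by
  obtain ⟨k, hk, φ, hφ, -, h2⟩ := h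
  rw [integral_congr_ae (hg.ae_unique hk)]
  have ik := memLp_two_integrable hk.memLp_deriv
  have h3 : Tendsto (fun n => eLpNorm (deriv (φ n) - k) 1 (lebI T)) atTop (𝓝 0) :=
    tendsto_of_tendsto_of_tendsto_of_le_of_le tendsto_const_nhds
      (tendsto_mul_const_zero (rpow_lebI_univ_ne_top T) h2) (fun _ => zero_le)
      fun n => eLpNorm_one_le_eLpNorm_two ((hφ n).deriv.integrable.sub ik).aestronglyMeasurable
  have h4 := tendsto_integral_of_L1' k ik.aestronglyMeasurable
    (Eventually.of_forall fun n => (hφ n).deriv.integrable) h3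
  simp only [(hφ _).integral_deriv hT] at h4
  exact tendsto_nhds_unique h4 tendsto_const_nhds

/-- Derivatives of test functions, as a subspace of `L²(0, T)`. -/
noncomputable def testDeriv (T : ℝ) : Submodule ℝ (L2I T) where
  carrier := {h | ∃ φ, IsTestFun T φ ∧ h =ᵐ[lebI T] deriv φ}
  add_mem' := by
    rintro a b ⟨φ, hφ, ha⟩ ⟨ψ, hψ, hb⟩
    refine ⟨φ + ψ, hφ.add hψ, ?_⟩
    filter_upwards [ha, hb, Lp.coeFn_add a b] with x h1 h2 h3
    rw [h3, Pi.add_apply, h1, h2, deriv_add (hφ.smooth.differentiable (by simp) x)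
      (hψ.smooth.differentiable (by simp) x)]
  zero_mem' := by
    refine ⟨0, isTestFun_zero T, ?_⟩
    filter_upwards [Lp.coeFn_zero ℝ 2 (lebI T)] with x hx
    rw [hx]
    simp
  smul_mem' := by
    rintro c a ⟨φ, hφ, ha⟩
    refine ⟨c • φ, hφ.smul c, ?_⟩
    filter_upwards [ha, Lp.coeFn_smul c a] with x h1 h2
    rw [h2, Pi.smul_apply, h1, deriv_const_smul _ (hφ.smooth.differentiable (by simp) x)]

theorem inner_L2I (T : ℝ) (g v : L2I T) : inner ℝ g v = ∫ x, v x * g x ∂(lebI T) := by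
  rw [L2.inner_def]
  simp

/-- By du Bois-Reymond the orthogonal complement of `testDeriv T` consists of constants, and g is
orthogonal to these. -/
theorem mem_closure_testDeriv {T : ℝ} (hT : 0 < T) {g : L2I T}
    (h0 : ∫ x, g x ∂(lebI T) = 0) : g ∈ (testDeriv T).topologicalClosure := by
  rw [← Submodule.orthogonal_orthogonal_eq_closure, Submodule.mem_orthogonal]
  intro h hh
  rw [Submodule.mem_orthogonal] at hh
  obtain ⟨c, hc⟩ := exists_ae_eq_const_of_forall_deriv hT (memLp_two_integrable (Lp.memLp h))
    fun φ hφ => by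
      have hm := hφ.deriv.bddCont.memLp 2 (lebI T)
      have h1 := hh (hm.toLp _) ⟨φ, hφ, hm.coeFn_toLp⟩
      rw [inner_L2I] at h1
      rw [← h1]
      exact integral_congr_ae (hm.coeFn_toLp.mono fun x hx => by simp only [hx])
  rw [inner_L2I, integral_congr_ae (g := fun x => g x * c) (hc.mono fun x hx => by simp only [hx]),
    integral_mul_const, h0, zero_mul]

theorem memH10_prim {T : ℝ} (hT : 0 < T) {g : ℝ → ℝ} (hg : MemLp g 2 (lebI T))
    (h0 : ∫ x, g x ∂(lebI T) = 0) : MemH10 T (prim T g) := by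
  have hi := memLp_two_integrable hg
  have h1 : hg.toLp g ∈ closure (testDeriv T : Set (L2I T)) := by
    rw [← Submodule.topologicalClosure_coe]
    refine mem_closure_testDeriv hT ?_
    rw [integral_congr_ae hg.coeFn_toLp, h0]
  obtain ⟨s, hs, hlim⟩ := mem_closure_iff_seq_limit.1 h1
  choose φ hφ hsφ using hs
  have hd : Tendsto (fun n => eLpNorm (fun x => deriv (φ n) x - g x) 2 (lebI T)) atTop (𝓝 0) := by
    refine (Lp.tendsto_Lp_iff_tendsto_eLpNorm' s _ |>.1 hlim).congr fun n => eLpNorm_congr_ae ?_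
    filter_upwards [hsφ n, hg.coeFn_toLp] with x h2 h3
    rw [Pi.sub_apply, h2, h3]
  refine ⟨g, hasWeakDerivI_prim hT hg, φ, hφ, ?_, hd⟩
  -- The sup norm of the difference is at most the L¹ norm of its derivative. One factor T^(1/2)
  -- comes from passing from sup to L², the other from L¹ to L².
  have hb : ∀ n, eLpNorm (fun x => φ n x - prim T g x) 2 (lebI T)
      ≤ eLpNorm (fun x => deriv (φ n) x - g x) 2 (lebI T)
        * ((lebI T) univ ^ (1 / 2 : ℝ) * (lebI T) univ ^ (1 / 2 : ℝ)) := by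
    intro n
    have hin := (hφ n).deriv.integrable.sub hi
    have hpt : ∀ᵐ x ∂(lebI T), ‖φ n x - prim T g x‖
        ≤ ∫ t, |deriv (φ n) t - g t| ∂(lebI T) := by
      refine (ae_restrict_mem measurableSet_Ioo).mono fun x hx => ?_
      rw [← (hφ n).prim_deriv hx.1.le hx.2.le, prim, prim,
        ← integral_sub (hφ n).deriv.integrable.integrableOn hi.integrableOn]
      exact abs_prim_le hin x
    have h2 := eLpNorm_le_of_ae_bound (p := 2) hpt
    refine h2.trans ?_
    have h3 : ENNReal.ofReal (∫ t, |deriv (φ n) t - g t| ∂(lebI T))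
        = eLpNorm (fun x => deriv (φ n) x - g x) 1 (lebI T) := by
      rw [eLpNorm_one_eq_lintegral_enorm]
      exact ofReal_integral_norm_eq_lintegral_enorm hin
    rw [h3, mul_comm, ← mul_assoc]
    refine (mul_le_mul' (eLpNorm_one_le_eLpNorm_two hin.aestronglyMeasurable) le_rfl).trans
      (le_of_eq ?_)
    norm_num
    rfl
  exact tendsto_of_tendsto_of_tendsto_of_le_of_le tendsto_const_nhds
    (tendsto_mul_const_zero (ENNReal.mul_ne_top (rpow_lebI_univ_ne_top T)
      (rpow_lebI_univ_ne_top T)) hd) (fun _ => zero_le) hb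

/-! ### The total generalized variation -/

theorem TGV_le {T α β : ℝ} (hα : 0 < α) (hβ : 0 < β) {u w : ℝ → ℝ} {μ ν : SignedMeasure ℝ}
    (hu : HasBVDeriv T u μ) (hw : HasBVDeriv T w ν) :
    TGV T α β u ≤ α * mNorm (μ - densityI T w) + β * mNorm ν := by
  refine csInf_le ⟨0, ?_⟩ ⟨w, μ, ν, hu, hw, rfl⟩
  rintro r ⟨w', μ', ν', -, -, rfl⟩
  have h1 := mNorm_nonneg (μ' - densityI T w')
  have h2 := mNorm_nonneg ν'
  positivity

theorem le_TGV {T α β c : ℝ} (hT : 0 < T) {u : ℝ → ℝ} (hu : MemBV T u)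
    (h : ∀ w μ ν, HasBVDeriv T u μ → HasBVDeriv T w ν →
      c ≤ α * mNorm (μ - densityI T w) + β * mNorm ν) : c ≤ TGV T α β u := by
  obtain ⟨μ, hμ⟩ := hu
  -- The real infimum of an empty set would be 0, so a competitor is needed: w = 0.
  refine le_csInf ⟨_, _, μ, 0, hμ, hasBVDeriv_const hT 0, rfl⟩ ?_
  rintro r ⟨w', μ', ν', h1, h2, rfl⟩
  exact h w' μ' ν' h1 h2

theorem TGV_congr {T α β : ℝ} {u v : ℝ → ℝ} (e : u =ᵐ[lebI T] v) :
    TGV T α β u = TGV T α β v := by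
  have h : ∀ μ, HasBVDeriv T u μ ↔ HasBVDeriv T v μ :=
    fun μ => ⟨fun h => h.congr e, fun h => h.congr e.symm⟩
  simp only [TGV, h]

theorem densityI_add_smul {T c : ℝ} {w w' : ℝ → ℝ} (hw : Integrable w (lebI T))
    (hw' : Integrable w' (lebI T)) :
    densityI T (fun x => w x + c * w' x) = densityI T w + c • densityI T w' := by
  have h := withDensityᵥ_add' hw (hw'.const_mul c)
  rw [densityI, h]
  congr 1
  exact withDensityᵥ_smul' w' c

/-- If w competes for u, then w + c w' competes for u + c v. -/
theorem TGV_add_smul_le {T α β c : ℝ} (hT : 0 < T) (hα : 0 < α) (hβ : 0 < β) {u v w' : ℝ → ℝ}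
    {μ' ν' : SignedMeasure ℝ} (hu : MemBV T u) (hv : HasBVDeriv T v μ') (hw' : HasBVDeriv T w' ν') :
    TGV T α β (fun x => u x + c * v x)
      ≤ TGV T α β u + |c| * (α * mNorm (μ' - densityI T w') + β * mNorm ν') := by
  rw [← sub_le_iff_le_add]
  refine le_TGV hT hu fun w μ ν h1 h2 => ?_
  rw [sub_le_iff_le_add]
  refine (TGV_le hα hβ (h1.add (hv.smul c)) (h2.add (hw'.smul c))).trans ?_
  have e : μ + c • μ' - densityI T (fun x => w x + c * w' x)
      = (μ - densityI T w) + c • (μ' - densityI T w') := by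
    rw [densityI_add_smul h2.integrable hw'.integrable]
    ext s _
    simp only [sub_apply, add_apply, smul_apply, smul_eq_mul]
    ring
  rw [e]
  have b1 := (mNorm_add_le (μ - densityI T w) (c • (μ' - densityI T w'))).trans
    (add_le_add le_rfl (mNorm_smul_le c (μ' - densityI T w')))
  have b2 := (mNorm_add_le ν (c • ν')).trans (add_le_add le_rfl (mNorm_smul_le c ν'))
  have b3 := mul_le_mul_of_nonneg_left b1 hα.le
  have b4 := mul_le_mul_of_nonneg_left b2 hβ.le
  linarith

theorem TGV_smul_le {T α β c : ℝ} (hT : 0 < T) (hα : 0 < α) (hβ : 0 < β) (hc : 0 < c) {u : ℝ → ℝ}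
    (hu : MemBV T u) : TGV T α β (fun x => c * u x) ≤ c * TGV T α β u := by
  rw [mul_comm, ← div_le_iff₀ hc]
  refine le_TGV hT hu fun w μ ν h1 h2 => ?_
  rw [div_le_iff₀ hc]
  refine (TGV_le hα hβ (h1.smul c) (h2.smul c)).trans ?_
  have e : c • μ - densityI T (fun x => c * w x) = c • (μ - densityI T w) := by
    have : densityI T (fun x => c * w x) = c • densityI T w := withDensityᵥ_smul' w c
    rw [this]
    ext s _
    simp only [sub_apply, smul_apply, smul_eq_mul]
    ring
  rw [e]
  have b3 := mul_le_mul_of_nonneg_left (mNorm_smul_le c (μ - densityI T w)) hα.le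
  have b4 := mul_le_mul_of_nonneg_left (mNorm_smul_le c ν) hβ.le
  rw [abs_of_pos hc] at b3 b4
  linarith

/-- The dual pairing of `v ∈ BV(0, T)` with `g`, through the first and second primitives of `g`. -/
theorem HasBVDeriv.integral_mul_eq_dual {T : ℝ} (hT : 0 < T) {v w g : ℝ → ℝ}
    {μ ν : SignedMeasure ℝ} (hv : HasBVDeriv T v μ) (hw : HasBVDeriv T w ν)
    (hg : Integrable g (lebI T)) (h0 : ∫ t, g t ∂(lebI T) = 0)
    (h1 : ∫ t, prim T g t ∂(lebI T) = 0) :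
    ∫ x, v x * g x ∂(lebI T) = -sIntegral (μ - densityI T w) (prim T g)
      - sIntegral ν (fun x => -prim T (prim T g) x) := by
  have hp := bddCont_prim hg
  rw [hv.integral_mul hT hg h0, sIntegral_sub _ _ hp, sIntegral_density hw.integrable hp,
    hw.integral_mul hT (hp.integrable _) h1, sIntegral_fun_neg]
  ring

/-- Weak duality: the left side does not involve w, so it also bounds TGV(v) from below. -/
theorem HasBVDeriv.neg_integral_mul_le {T α β : ℝ} (hT : 0 < T) {v w g : ℝ → ℝ}
    {μ ν : SignedMeasure ℝ} (hv : HasBVDeriv T v μ) (hw : HasBVDeriv T w ν)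
    (hg : Integrable g (lebI T)) (h0 : ∫ t, g t ∂(lebI T) = 0)
    (h1 : ∫ t, prim T g t ∂(lebI T) = 0) (hp : ∀ x ∈ Ioo 0 T, |prim T g x| ≤ α)
    (hP : ∀ x ∈ Ioo 0 T, |-prim T (prim T g) x| ≤ β) :
    -∫ x, v x * g x ∂(lebI T) ≤ α * mNorm (μ - densityI T w) + β * mNorm ν := by
  rw [hv.integral_mul_eq_dual hT hw hg h0 h1]
  have b1 := sIntegral_le (LivesOn.sub hv.concentrated (livesOn_density T w)) (bddCont_prim hg) hp
  have b2 := sIntegral_le hw.concentrated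
    (bddCont_prim ((bddCont_prim hg).integrable (lebI T))).neg hP
  linarith

/-! ### First-order conditions -/

theorem le_of_hasDerivAt_of_forall_le {F : ℝ → ℝ} {m r : ℝ} (h : HasDerivAt F m 0)
    (hF : ∀ t ∈ Ioo (0 : ℝ) 1, F 0 + t * r ≤ F t) : r ≤ m := by
  have h1 : Tendsto (slope F 0) (𝓝[>] 0) (𝓝 m) :=
    (hasDerivAt_iff_tendsto_slope.1 h).mono_left (nhdsWithin_mono _ fun x hx => ne_of_gt hx)
  refine ge_of_tendsto h1 ?_
  filter_upwards [Ioo_mem_nhdsGT (zero_lt_one (α := ℝ))] with t ht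
  rw [slope_def_field, sub_zero, le_div_iff₀ ht.1]
  linarith [hF t ht]

theorem hasDerivAt_add_smul {E : Type*} [NormedAddCommGroup E] [InnerProductSpace ℝ E]
    [CompleteSpace E] {f : E → ℝ} {u : E} (hf : DifferentiableAt ℝ f u) (v : E) :
    HasDerivAt (fun t : ℝ => f (u + t • v)) (inner ℝ (∇ f u) v) 0 := by
  have h1 : HasDerivAt (fun t : ℝ => u + t • v) v 0 := by
    simpa using ((hasDerivAt_id (0 : ℝ)).smul_const v).const_add u
  have h2 : HasFDerivAt f (fderiv ℝ f u) (u + (0 : ℝ) • v) := by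
    simpa using hf.hasFDerivAt
  have h3 := h2.comp_hasDerivAt (0 : ℝ) h1
  have h4 : inner ℝ (∇ f u) v = fderiv ℝ f u v := by
    rw [← toDual_gradient]
    rfl
  rw [h4]
  exact h3

/-- The gradient inequality for convex functions. -/
theorem ConvexOn.inner_gradient_le {E : Type*} [NormedAddCommGroup E] [InnerProductSpace ℝ E]
    [CompleteSpace E] {f : E → ℝ} (hc : ConvexOn ℝ univ f) {u : E} (hf : DifferentiableAt ℝ f u)
    (v : E) : inner ℝ (∇ f u) (v - u) ≤ f v - f u := by
  have h := (hasDerivAt_add_smul hf (v - u)).neg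
  have h1 := le_of_hasDerivAt_of_forall_le (r := -(f v - f u)) h fun t ht => by
    have h2 := hc.2 (mem_univ u) (mem_univ v) (by linarith [ht.2] : 0 ≤ 1 - t) ht.1.le (by ring)
    have e : (1 - t) • u + t • v = u + t • (v - u) := by
      rw [sub_smul, one_smul, smul_sub]; abel
    rw [e] at h2
    simp only [smul_eq_mul] at h2
    simp only [Pi.neg_apply, zero_smul, add_zero]
    linarith
  linarith

theorem coeFn_add_smul {T : ℝ} (u v : L2I T) (t : ℝ) :
    (u + t • v : L2I T) =ᵐ[lebI T] fun x => u x + t * v x := by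
  filter_upwards [Lp.coeFn_add u (t • v), Lp.coeFn_smul t v] with x h1 h2
  rw [h1, Pi.add_apply, h2, Pi.smul_apply, smul_eq_mul]

theorem memBV_add_smul {T : ℝ} {u v : L2I T} (hu : MemBV T u) (hv : MemBV T v) (t : ℝ) :
    MemBV T (u + t • v : L2I T) := by
  obtain ⟨μ, hμ⟩ := hu
  obtain ⟨ν, hν⟩ := hv
  exact ⟨_, (hμ.add (hν.smul t)).congr (coeFn_add_smul u v t).symm⟩

/-! ### Optimality conditions -/

section Minimizer

variable {T α β : ℝ} {f : L2I T → ℝ} {u : L2I T}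

/-- TGV need not be differentiable; a linear upper bound on its growth along the ray suffices. -/
theorem IsTGVMinimizer.neg_le_inner (hf : Differentiable ℝ f) (hu : IsTGVMinimizer T α β f u)
    {v : L2I T} (hv : MemBV T v) {r : ℝ}
    (h : ∀ t ∈ Ioo (0 : ℝ) 1, TGV T α β (u + t • v : L2I T) ≤ TGV T α β u + t * r) :
    -r ≤ inner ℝ (∇ f u) v := by
  refine le_of_hasDerivAt_of_forall_le (hasDerivAt_add_smul (hf u) v) fun t ht => ?_
  have h1 := hu.2 _ (memBV_add_smul hu.1 hv t)
  have h2 := h t ht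
  simp only [zero_smul, add_zero]
  linarith

theorem IsTGVMinimizer.abs_integral_mul_le (hT : 0 < T) (hα : 0 < α) (hβ : 0 < β)
    (hf : Differentiable ℝ f) (hu : IsTGVMinimizer T α β f u) {v w : ℝ → ℝ}
    {μ ν : SignedMeasure ℝ} (hv : HasBVDeriv T v μ) (hw : HasBVDeriv T w ν)
    (hv2 : MemLp v 2 (lebI T)) :
    |∫ x, v x * (∇ f u : L2I T) x ∂(lebI T)| ≤ α * mNorm (μ - densityI T w) + β * mNorm ν := by
  have hV : HasBVDeriv T (hv2.toLp v) μ := hv.congr hv2.coeFn_toLp.symm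
  have hi : inner ℝ (∇ f u) (hv2.toLp v) = ∫ x, v x * (∇ f u : L2I T) x ∂(lebI T) := by
    rw [inner_L2I]
    exact integral_congr_ae (hv2.coeFn_toLp.mono fun x hx => by simp only [hx])
  have key : ∀ t, TGV T α β (u + t • hv2.toLp v : L2I T)
      ≤ TGV T α β u + |t| * (α * mNorm (μ - densityI T w) + β * mNorm ν) := fun t => by
    rw [TGV_congr (coeFn_add_smul u (hv2.toLp v) t)]
    exact TGV_add_smul_le hT hα hβ hu.1 hV hw
  rw [← hi, abs_le]
  constructor
  · refine hu.neg_le_inner hf ⟨μ, hV⟩ fun t ht => ?_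
    have := key t
    rwa [abs_of_pos ht.1] at this
  -- The bound depends only on |t|, so the direction -v gives the opposite inequality.
  · have hn : MemBV T (-hv2.toLp v : L2I T) := by
      refine ⟨_, (hV.smul (-1)).congr ?_⟩
      filter_upwards [Lp.coeFn_neg (hv2.toLp v)] with x hx
      rw [hx, Pi.neg_apply, neg_one_mul]
    have h1 := hu.neg_le_inner hf hn fun t ht => by
      have := key (-t)
      rwa [abs_neg, abs_of_pos ht.1, neg_smul, ← smul_neg] at this
    rw [inner_neg_right] at h1
    linarith

/-- Moving towards 0 scales u by 1 - t, which lowers TGV by at least t TGV(u). This is the reverse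
of weak duality at u. -/
theorem IsTGVMinimizer.TGV_le_neg_inner (hT : 0 < T) (hα : 0 < α) (hβ : 0 < β)
    (hf : Differentiable ℝ f) (hu : IsTGVMinimizer T α β f u) :
    TGV T α β u ≤ -∫ x, u x * (∇ f u : L2I T) x ∂(lebI T) := by
  obtain ⟨μ, hμ⟩ := hu.1
  have hn : MemBV T (-u : L2I T) := by
    refine ⟨_, (hμ.smul (-1)).congr ?_⟩
    filter_upwards [Lp.coeFn_neg u] with x hx
    rw [hx, Pi.neg_apply, neg_one_mul]
  have h1 := hu.neg_le_inner (r := -TGV T α β u) hf hn fun t ht => by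
    have e : (u + t • -u : L2I T) =ᵐ[lebI T] fun x => (1 - t) * u x := by
      filter_upwards [coeFn_add_smul u (-u) t, Lp.coeFn_neg u] with x h2 h3
      rw [h2, h3, Pi.neg_apply]
      ring
    rw [TGV_congr e]
    have := TGV_smul_le hT hα hβ (by linarith [ht.2] : 0 < 1 - t) hu.1
    linarith
  rw [inner_neg_right, inner_L2I] at h1
  linarith

end Minimizer

/-- The second primitive of `g`, with the sign of the dual variable, lies in `H²(0, T)`. -/
theorem memH2_neg_prim_prim {T : ℝ} (hT : 0 < T) {g : ℝ → ℝ} (hg : MemLp g 2 (lebI T)) :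
    MemH2 T fun x => -prim T (prim T g) x :=
  ⟨_, _, (hasWeakDerivI_prim hT ((hasWeakDerivI_prim hT hg).memLp)).neg,
    (hasWeakDerivI_prim hT hg).neg⟩

theorem dualSmallP_eq_prim {T x : ℝ} (f : L2I T → ℝ) (u : L2I T) (hx : x ∈ Icc 0 T) :
    dualSmallP T f u x = prim T (∇ f u : L2I T) x :=
  (prim_eq_intervalIntegral _ hx.1 hx.2).symm

theorem dualBigP_eq_prim {T x : ℝ} (f : L2I T → ℝ) (u : L2I T) (hx : x ∈ Icc 0 T) :
    dualBigP T f u x = -prim T (prim T (∇ f u : L2I T)) x := by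
  rw [dualBigP, prim_eq_intervalIntegral _ hx.1 hx.2]
  congr 1
  refine intervalIntegral.integral_congr fun t ht => ?_
  rw [uIcc_of_le hx.1] at ht
  exact dualSmallP_eq_prim f u ⟨ht.1, ht.2.trans hx.2⟩

theorem BoundCond.congr {T α β : ℝ} {p p' P P' : ℝ → ℝ} (h : BoundCond T α β p P)
    (e : ∀ x ∈ Ioo 0 T, p x = p' x) (E : ∀ x ∈ Ioo 0 T, P x = P' x) : BoundCond T α β p' P' := by
  obtain ⟨h1, ⟨h2, h3⟩, h4, h5⟩ := h
  have e' : p =ᵐ[lebI T] p' := (ae_restrict_mem measurableSet_Ioo).mono e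
  have E' : P =ᵐ[lebI T] P' := (ae_restrict_mem measurableSet_Ioo).mono E
  exact ⟨h1.congr e', ⟨h2.congr E', h3.congr E'⟩, fun x hx => e x hx ▸ h4 x hx,
    fun x hx => E x hx ▸ h5 x hx⟩

theorem IsTGVMinimizer.integral_gradient_eq_zero {T α β : ℝ} {f : L2I T → ℝ} {u : L2I T}
    (hT : 0 < T) (hα : 0 < α) (hβ : 0 < β) (hf : Differentiable ℝ f)
    (hu : IsTGVMinimizer T α β f u) :
    ∫ x, (∇ f u : L2I T) x ∂(lebI T) = 0 ∧ ∫ x, prim T (∇ f u : L2I T) x ∂(lebI T) = 0 := by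
  have hi := memLp_two_integrable (Lp.memLp (∇ f u))
  have h0 : ∫ x, (∇ f u : L2I T) x ∂(lebI T) = 0 := by
    -- v = 1 and w = 0 have zero cost.
    have h := hu.abs_integral_mul_le hT hα hβ hf (hasBVDeriv_const hT 1) (hasBVDeriv_const hT 0)
      (memLp_const 1)
    have e : densityI T (fun _ => 0) = 0 := withDensityᵥ_zero
    rw [e, sub_zero, mNorm_zero, mul_zero, mul_zero, add_zero] at h
    simpa using abs_nonpos_iff.1 h
  refine ⟨h0, ?_⟩
  have h1 : Integrable (fun _ : ℝ => (1 : ℝ)) (lebI T) := integrable_const 1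
  -- v(x) = x on (0, T) and w = 1 satisfy Dv = w and Dw = 0, again at zero cost; ∫ v g is minus the
  -- mean of p.
  have h := hu.abs_integral_mul_le hT hα hβ hf (hasBVDeriv_prim hT h1) (hasBVDeriv_const hT 1)
    ((bddCont_prim h1).memLp _ _)
  rw [sub_self, mNorm_zero, mul_zero, mul_zero, add_zero] at h
  have h2 := abs_nonpos_iff.1 h
  rw [(hasBVDeriv_prim hT h1).integral_mul hT hi h0, sIntegral_density h1 (bddCont_prim hi)] at h2
  simpa using h2

theorem IsTGVMinimizer.abs_prim_gradient_le {T α β : ℝ} {f : L2I T → ℝ} {u : L2I T}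
    (hT : 0 < T) (hα : 0 < α) (hβ : 0 < β) (hf : Differentiable ℝ f)
    (hu : IsTGVMinimizer T α β f u) {y : ℝ} (hy : y ∈ Ioo 0 T) :
    |prim T (∇ f u : L2I T) y| ≤ α ∧ |-prim T (prim T (∇ f u : L2I T)) y| ≤ β := by
  have hi := memLp_two_integrable (Lp.memLp (∇ f u))
  obtain ⟨h0, h1⟩ := hu.integral_gradient_eq_zero hT hα hβ hf
  set δ : SignedMeasure ℝ := (Measure.dirac y).toSignedMeasure with hδ
  have hJ : HasBVDeriv T (fun x => δ (Iic x)) δ := hasBVDeriv_Iic hT (livesOn_dirac hy)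
  have hδi := mNorm_dirac_le y
  rw [← hδ] at hδi
  constructor
  -- v is the unit step at y and w = 0: the cost is at most α and ∫ v g = -p(y).
  · have hJ2 : MemLp (fun x => δ (Iic x)) 2 (lebI T) := by
      refine MemLp.of_bound hJ.integrable.aestronglyMeasurable 1 (ae_of_all _ fun x => ?_)
      rw [hδ, Measure.toSignedMeasure_apply_measurable measurableSet_Iic,
        Real.norm_of_nonneg measureReal_nonneg]
      exact measureReal_le_one
    have h := hu.abs_integral_mul_le hT hα hβ hf hJ (hasBVDeriv_const hT 0) hJ2
    have e : densityI T (fun _ => 0) = 0 := withDensityᵥ_zero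
    rw [e, sub_zero, mNorm_zero, mul_zero, add_zero, hJ.integral_mul hT hi h0, hδ,
      sIntegral_toSignedMeasure _ (bddCont_prim hi), integral_dirac, abs_neg] at h
    exact h.trans (mul_le_of_le_one_right hα.le hδi)
  -- v is the ramp starting at y and w = Dv the step: the cost is at most β and ∫ v g = -P(y).
  · have hp := bddCont_prim hi
    have hR := hasBVDeriv_prim hT hJ.integrable
    have h := hu.abs_integral_mul_le hT hα hβ hf hR hJ ((bddCont_prim hJ.integrable).memLp _ _)
    rw [sub_self, mNorm_zero, mul_zero, zero_add, hR.integral_mul_eq_dual hT hJ hi h0 h1, sub_self,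
      sIntegral_zero, neg_zero, zero_sub, abs_neg, hδ, sIntegral_toSignedMeasure _
      (bddCont_prim (hp.integrable (lebI T))).neg, integral_dirac] at h
    exact h.trans (mul_le_of_le_one_right hβ.le hδi)

theorem IsTGVMinimizer.boundCond {T α β : ℝ} {f : L2I T → ℝ} {u : L2I T}
    (hT : 0 < T) (hα : 0 < α) (hβ : 0 < β) (hf : Differentiable ℝ f)
    (hu : IsTGVMinimizer T α β f u) :
    BoundCond T α β (prim T (∇ f u : L2I T)) fun x => -prim T (prim T (∇ f u : L2I T)) x := by
  obtain ⟨h0, h1⟩ := hu.integral_gradient_eq_zero hT hα hβ hf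
  have h2 := Lp.memLp (∇ f u)
  exact ⟨memH10_prim hT h2 h0, ⟨memH2_neg_prim_prim hT h2,
    (memH10_prim hT (hasWeakDerivI_prim hT h2).memLp h1).neg⟩,
    fun y hy => (hu.abs_prim_gradient_le hT hα hβ hf hy).1,
    fun y hy => (hu.abs_prim_gradient_le hT hα hβ hf hy).2⟩

theorem IsTGVMinimizer.suppCond {T α β : ℝ} {f : L2I T → ℝ} {u : L2I T}
    (hT : 0 < T) (hα : 0 < α) (hβ : 0 < β) (hf : Differentiable ℝ f)
    (hu : IsTGVMinimizer T α β f u) {w : ℝ → ℝ} {μ ν : SignedMeasure ℝ} (hμ : HasBVDeriv T u μ)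
    (hw : HasBVDeriv T w ν)
    (h : TGV T α β u = α * mNorm (μ - densityI T w) + β * mNorm ν) :
    SuppCond T α (μ - densityI T w) (prim T (∇ f u : L2I T)) ∧
      SuppCond T β ν fun x => -prim T (prim T (∇ f u : L2I T)) x := by
  have hi := memLp_two_integrable (Lp.memLp (∇ f u))
  obtain ⟨h0, h1⟩ := hu.integral_gradient_eq_zero hT hα hβ hf
  have hp := bddCont_prim hi
  have hP := (bddCont_prim (hp.integrable (lebI T))).neg
  have hpb := fun y hy => (hu.abs_prim_gradient_le hT hα hβ hf (y := y) hy).1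
  have hPb := fun y hy => (hu.abs_prim_gradient_le hT hα hβ hf (y := y) hy).2
  have l1 : LivesOn T (μ - densityI T w) := LivesOn.sub hμ.concentrated (livesOn_density T w)
  have l2 : LivesOn T ν := hw.concentrated
  have b := hu.TGV_le_neg_inner hT hα hβ hf
  rw [hμ.integral_mul_eq_dual hT hw hi h0 h1, h] at b
  have b1 := sIntegral_le l1 hp hpb
  have b2 := sIntegral_le l2 hP hPb
  -- The bounds `b1` and `b2` add up to the reverse of `b`, so each of them is an equality.
  exact ⟨suppCond_of_sIntegral_eq l1 hp hpb (by linarith),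
    suppCond_of_sIntegral_eq l2 hP hPb (by linarith)⟩

/-- Membership of p and P in H¹₀ enters through the vanishing means of g and p; the support
conditions then make weak duality sharp at u. -/
theorem isTGVMinimizer_of_suppCond {T α β : ℝ} {f : L2I T → ℝ} {u : L2I T}
    (hT : 0 < T) (hf : Differentiable ℝ f) (hc : ConvexOn ℝ univ f)
    {w : ℝ → ℝ} {μ ν : SignedMeasure ℝ} (hμ : HasBVDeriv T u μ) (hw : HasBVDeriv T w ν)
    (h : TGV T α β u = α * mNorm (μ - densityI T w) + β * mNorm ν)
    (hb : BoundCond T α β (prim T (∇ f u : L2I T)) fun x => -prim T (prim T (∇ f u : L2I T)) x)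
    (s1 : SuppCond T α (μ - densityI T w) (prim T (∇ f u : L2I T)))
    (s2 : SuppCond T β ν fun x => -prim T (prim T (∇ f u : L2I T)) x) :
    IsTGVMinimizer T α β f u := by
  have h2 := Lp.memLp (∇ f u)
  have hi := memLp_two_integrable h2
  obtain ⟨b1, ⟨-, b2⟩, b3, b4⟩ := hb
  have h0 := integral_eq_zero_of_memH10 hT b1 (hasWeakDerivI_prim hT h2)
  have h1 : ∫ x, prim T (∇ f u : L2I T) x ∂(lebI T) = 0 := by
    have := integral_eq_zero_of_memH10 hT b2
      (hasWeakDerivI_prim hT (hasWeakDerivI_prim hT h2).memLp).neg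
    rw [integral_neg] at this
    linarith
  have e1 := sIntegral_eq_of_suppCond (LivesOn.sub hμ.concentrated (livesOn_density T w)) s1
  have e2 := sIntegral_eq_of_suppCond hw.concentrated s2
  have e3 := hμ.integral_mul_eq_dual hT hw hi h0 h1
  refine ⟨⟨μ, hμ⟩, fun v hv => ?_⟩
  have hvT : -∫ x, v x * (∇ f u : L2I T) x ∂(lebI T) ≤ TGV T α β v :=
    le_TGV hT hv fun w' μ' ν' k1 k2 => k1.neg_integral_mul_le hT k2 hi h0 h1 b3 b4
  have hg := hc.inner_gradient_le (hf u) v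
  rw [inner_sub_right, inner_L2I, inner_L2I] at hg
  linarith

theorem theorem4p6 (T α β : ℝ) (hT : 0 < T) (hα : 0 < α) (hβ : 0 < β)
    (f : L2I T → ℝ) (hf : Differentiable ℝ f) (u : L2I T) :
    (IsTGVMinimizer T α β f u →
      BoundCond T α β (dualSmallP T f u) (dualBigP T f u) ∧
      ∀ (w : ℝ → ℝ) (Du Dw : SignedMeasure ℝ), HasBVDeriv T u Du → HasBVDeriv T w Dw →
        TGV T α β u = α * mNorm (Du - densityI T w) + β * mNorm Dw →
        SuppCond T α (Du - densityI T w) (dualSmallP T f u) ∧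
          SuppCond T β Dw (dualBigP T f u)) ∧
    (ConvexOn ℝ univ f →
      ∀ (w : ℝ → ℝ) (Du Dw : SignedMeasure ℝ), HasBVDeriv T u Du → HasBVDeriv T w Dw →
        TGV T α β u = α * mNorm (Du - densityI T w) + β * mNorm Dw →
        BoundCond T α β (dualSmallP T f u) (dualBigP T f u) →
        SuppCond T α (Du - densityI T w) (dualSmallP T f u) →
        SuppCond T β Dw (dualBigP T f u) →
        IsTGVMinimizer T α β f u) := by
  have ep : ∀ x ∈ Ioo 0 T, prim T (∇ f u : L2I T) x = dualSmallP T f u x :=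
    fun x hx => (dualSmallP_eq_prim f u (Ioo_subset_Icc_self hx)).symm
  have eP : ∀ x ∈ Ioo 0 T, -prim T (prim T (∇ f u : L2I T)) x = dualBigP T f u x :=
    fun x hx => (dualBigP_eq_prim f u (Ioo_subset_Icc_self hx)).symm
  refine ⟨fun hu => ⟨(hu.boundCond hT hα hβ hf).congr ep eP, fun w Du Dw h1 h2 h => ?_⟩,
    fun hc w Du Dw h1 h2 h hb s1 s2 => ?_⟩
  · obtain ⟨s1, s2⟩ := hu.suppCond hT hα hβ hf h1 h2 h
    exact ⟨s1.congr ep, s2.congr eP⟩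
  · have ep' := fun x hx => (ep x hx).symm
    have eP' := fun x hx => (eP x hx).symm
    exact isTGVMinimizer_of_suppCond hT hf hc h1 h2 h (hb.congr ep' eP') (s1.congr ep')
      (s2.congr eP')
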